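/- Let $K$ be a field of characteristic $0$, let $S = K[x,y,z]$ with its standard grading, and let $I = \langle l_1^{d_1},\dots,l_n^{d_n}\rangle \subseteq S$ be an ideal generated by powers of linear forms $l_1,\dots,l_n \in S_1$ such that $A = S/I$ is Artinian. Then $A$ has the Weak Lefschetz Property: there is a linear form $\ell \in S_1$ such that for every $m$ the multiplication map $A_m \xrightarrow{\ \cdot \ell\ } A_{m+1}$ is injective or surjective. Moreover, this holds for a general linear form: there is a nonzero polynomial $P \in K[a,b,c]$ such that every $\ell = ax+by+cz$ with $a,b,c \in K$ and $P(a,b,c) \neq 0$ has the property that for every $m$ the map $A_m \xrightarrow{\ \cdot \ell\ } A_{m+1}$ is injective or surjective. (No semistability of the syzygy bundle of $I$ is assumed.) -/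

import Mathlib

namespace WeakLefschetz

open MvPolynomial

noncomputable section

variable {K : Type*} [Field K] {r : ℕ}

/-- The degree `m` component `A_m` of `A = S/I`, where `S = K[x_1, …, x_r]` and `I` is a
homogeneous ideal: the image in `S/I` of the space `S_m` of forms of degree `m`. -/
def gradedPiece (I : Ideal (MvPolynomial (Fin r) K)) (m : ℕ) :
    Submodule K (MvPolynomial (Fin r) K ⧸ I) :=
  (homogeneousSubmodule (Fin r) K m).map (Ideal.Quotient.mkₐ K I).toLinearMap

theorem mul_mem_gradedPiece (I : Ideal (MvPolynomial (Fin r) K))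
    (ℓ : homogeneousSubmodule (Fin r) K 1) (m : ℕ)
    (a : MvPolynomial (Fin r) K ⧸ I) (ha : a ∈ gradedPiece I m) :
    LinearMap.mulLeft K (Ideal.Quotient.mk I (ℓ : MvPolynomial (Fin r) K)) a ∈
      gradedPiece I (m + 1) := by
  obtain ⟨f, hf, rfl⟩ := ha
  refine ⟨(ℓ : MvPolynomial (Fin r) K) * f, ?_, ?_⟩
  · have h := IsHomogeneous.mul ((mem_homogeneousSubmodule 1 _).1 ℓ.2)
      ((mem_homogeneousSubmodule m f).1 hf)
    rw [add_comm] at h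
    exact (mem_homogeneousSubmodule (m + 1) _).2 h
  · simp

/-- Multiplication by the linear form `ℓ`, as a `K`-linear map `A_m → A_{m+1}`. -/
def mulMap (I : Ideal (MvPolynomial (Fin r) K)) (ℓ : homogeneousSubmodule (Fin r) K 1) (m : ℕ) :
    gradedPiece I m →ₗ[K] gradedPiece I (m + 1) :=
  (LinearMap.mulLeft K (Ideal.Quotient.mk I (ℓ : MvPolynomial (Fin r) K))).restrict
    (mul_mem_gradedPiece I ℓ m)

/-- `ℓ` is a weak Lefschetz element for `S/I`: for every `m` the map `A_m → A_{m+1}` given by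
multiplication by `ℓ` is injective or surjective. -/
def IsLefschetzForm (I : Ideal (MvPolynomial (Fin r) K))
    (ℓ : homogeneousSubmodule (Fin r) K 1) : Prop :=
  ∀ m : ℕ, Function.Injective (mulMap I ℓ m) ∨ Function.Surjective (mulMap I ℓ m)

/-- The Weak Lefschetz Property of `S/I`. -/
def HasWLP (I : Ideal (MvPolynomial (Fin r) K)) : Prop :=
  ∃ ℓ : homogeneousSubmodule (Fin r) K 1, IsLefschetzForm I ℓ

/-- The linear form `a_1 x_1 + ⋯ + a_r x_r`. -/
def linearForm (a : Fin r → K) : homogeneousSubmodule (Fin r) K 1 :=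
  ∑ i, a i • ⟨X i, (mem_homogeneousSubmodule 1 _).2 (isHomogeneous_X K i)⟩

/-- A property holds for a general linear form: it holds for `a_1 x_1 + ⋯ + a_r x_r` whenever
`(a_1, …, a_r)` lies outside the zero locus of some fixed nonzero polynomial. -/
def ForGeneralLinearForm (p : homogeneousSubmodule (Fin r) K 1 → Prop) : Prop :=
  ∃ P : MvPolynomial (Fin r) K, P ≠ 0 ∧ ∀ a : Fin r → K, eval a P ≠ 0 → p (linearForm a)

end

end WeakLefschetz

namespace WeakLefschetz

open MvPolynomial

variable {K : Type*} [Field K]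

/-! Restrict to the plane `ℓ = 0`, that is, to `K[x, y]`. After discarding redundant generators the
`l_i` are nonzero and pairwise non-proportional, and so are their restrictions when `ℓ` is general.
In two variables the degree `m + 1` multiples of the restricted `l_i ^ d_i` form a space of
dimension `max(0, m + 2 - d_i)`. In characteristic zero these spaces are independent if the
dimensions add up to at most `m + 2` (`eq_zero_of_sum_eq_zero`), and span all forms if the sum is at
least `m + 2` (`exists_sum_eq`).

Independence gives injectivity: if `ℓ f = ∑ g_i l_i ^ d_i`, every `g_i` restricts to zero, hence is
divisible by `ℓ`, and cancelling `ℓ` puts `f` in `I`. Spanning gives surjectivity, since `A / ℓA`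
vanishes in degree `m + 1`. -/

/-! ### Linear forms and homogeneous components -/

/-- The linear form with coefficient vector `a`, as a polynomial. -/
noncomputable def lin {r : ℕ} (a : Fin r → K) : MvPolynomial (Fin r) K := ∑ i, C (a i) * X i

theorem isHomogeneous_lin {r : ℕ} (a : Fin r → K) : (lin a).IsHomogeneous 1 :=
  IsHomogeneous.sum _ _ _ fun i _ => isHomogeneous_C_mul_X (a i) i

theorem coe_linearForm {r : ℕ} (a : Fin r → K) :
    (linearForm a : MvPolynomial (Fin r) K) = lin a := by
  simp [linearForm, lin, smul_eq_C_mul]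

theorem exists_eq_lin {r : ℕ} {f : MvPolynomial (Fin r) K} (hf : f.IsHomogeneous 1) :
    ∃ a, f = lin a := by
  have h : f ∈ Submodule.span K (Set.range (X : Fin r → MvPolynomial (Fin r) K)) := by
    rw [← homogeneousSubmodule_one_eq_span_X]; exact hf
  obtain ⟨a, rfl⟩ := (Submodule.mem_span_range_iff_exists_fun K).1 h
  exact ⟨a, by simp [lin, smul_eq_C_mul]⟩

theorem coeff_lin {r : ℕ} (a : Fin r → K) (i : Fin r) :
    coeff (Finsupp.single i 1) (lin a) = a i := by
  simp [lin, coeff_sum, coeff_C_mul, coeff_X, Finsupp.single_left_inj]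

theorem lin_ne_zero {r : ℕ} {a : Fin r → K} (ha : a ≠ 0) : lin a ≠ 0 := by
  intro h
  apply ha
  ext i
  rw [← coeff_lin a i, h]
  simp

theorem lin_smul {r : ℕ} (c : K) (a : Fin r → K) : lin (c • a) = C c * lin a := by
  simp [lin, Finset.mul_sum, mul_assoc]

theorem homogeneousComponent_mul_of_isHomogeneous {σ : Type*} {p : MvPolynomial σ K} {d : ℕ}
    (hp : p.IsHomogeneous d) (N : ℕ) (g : MvPolynomial σ K) :
    homogeneousComponent N (g * p) =
      (if d ≤ N then homogeneousComponent (N - d) g else 0) * p := by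
  have key : ∀ j, homogeneousComponent N (homogeneousComponent j g * p) =
      if j + d = N then homogeneousComponent j g * p else 0 := fun j => by
    rw [homogeneousComponent_of_mem (((homogeneousComponent_isHomogeneous j g).mul hp))]
    simp only [eq_comm]
  conv_lhs => rw [← sum_homogeneousComponent g, Finset.sum_mul, map_sum]
  simp only [key]
  split_ifs with h
  · have h' : ∀ j, j + d = N ↔ j = N - d := fun j => by omega
    simp only [h', Finset.sum_ite_eq', Finset.mem_range]
    split_ifs with h2
    · rfl
    · rw [homogeneousComponent_eq_zero _ _ (by omega), zero_mul]
  · rw [zero_mul]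
    exact Finset.sum_eq_zero fun j _ => if_neg (by omega)

theorem eq_zero_of_pow_dvd {σ : Type*} {L f : MvPolynomial σ K} {m k : ℕ}
    (hL : L.IsHomogeneous 1) (hf : f.IsHomogeneous m) (hk : m < k) (h : L ^ k ∣ f) : f = 0 := by
  by_contra h0
  obtain ⟨q, rfl⟩ := h
  have hL0 := left_ne_zero_of_mul h0
  have h1 := hf.totalDegree h0
  rw [totalDegree_mul_of_isDomain hL0 (right_ne_zero_of_mul h0),
    (hL.pow k).totalDegree hL0] at h1
  omega

/-! ### Independence of multiples of powers in two variables -/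

/-- The derivation of `K[x, y]` annihilating the linear form `a x + b y`. -/
noncomputable def killDeriv (v : Fin 2 → K) :
    Derivation K (MvPolynomial (Fin 2) K) (MvPolynomial (Fin 2) K) :=
  v 1 • pderiv 0 - v 0 • pderiv 1

theorem killDeriv_lin (v w : Fin 2 → K) :
    killDeriv v (lin w) = C (v 1 * w 0 - v 0 * w 1) := by
  simp [killDeriv, lin, pderiv_X, Fin.sum_univ_two, smul_eq_C_mul]

theorem isHomogeneous_killDeriv (v : Fin 2 → K) {f : MvPolynomial (Fin 2) K} {m : ℕ}
    (hf : f.IsHomogeneous m) : (killDeriv v f).IsHomogeneous (m - 1) :=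
  (homogeneousSubmodule (Fin 2) K (m - 1)).sub_mem
    ((homogeneousSubmodule (Fin 2) K (m - 1)).smul_mem _ hf.pderiv)
    ((homogeneousSubmodule (Fin 2) K (m - 1)).smul_mem _ hf.pderiv)

theorem pow_dvd_killDeriv_self (v : Fin 2 → K) {f : MvPolynomial (Fin 2) K} {d : ℕ}
    (h : lin v ^ d ∣ f) : lin v ^ d ∣ killDeriv v f := by
  obtain ⟨q, rfl⟩ := h
  have : killDeriv v (lin v) = 0 := by rw [killDeriv_lin, mul_comm, sub_self, C_0]
  rw [Derivation.leibniz, Derivation.leibniz_pow, this]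
  simp

theorem pow_dvd_derivation {R A : Type*} [CommRing R] [CommRing A] [Algebra R A]
    (D : Derivation R A A) {L f : A} {d : ℕ} (h : L ^ d ∣ f) : L ^ (d - 1) ∣ D f := by
  obtain ⟨q, rfl⟩ := h
  rw [Derivation.leibniz, Derivation.leibniz_pow]
  simp only [smul_eq_mul, nsmul_eq_mul]
  refine dvd_add (Dvd.dvd.mul_right (pow_dvd_pow _ (Nat.sub_le _ _)) _) ?_
  exact Dvd.intro_left (q * (d * D L)) (by ring)

/-- If `f = w ^ (k + 1) * q`, then `D f = 0` makes `w` divide `(k + 1) * D w * q`, where `(k + 1) *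
D w` is a nonzero constant in characteristic zero. So `w` divides `f` to every order. -/
theorem eq_zero_of_killDeriv_eq_zero [CharZero K] {v w : Fin 2 → K} (hvw : v 1 * w 0 - v 0 * w 1 ≠ 0)
    {f : MvPolynomial (Fin 2) K} {m : ℕ} (hf : f.IsHomogeneous m)
    (hD : killDeriv v f = 0) (hdvd : lin w ∣ f) : f = 0 := by
  have hw : lin w ≠ 0 := lin_ne_zero fun h => hvw (by simp [h])
  have all : ∀ k, lin w ^ (k + 1) ∣ f := by
    intro k
    induction k with
    | zero => simpa using hdvd
    | succ k ih =>
      obtain ⟨q, rfl⟩ := ih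
      rw [Derivation.leibniz, Derivation.leibniz_pow, killDeriv_lin] at hD
      simp only [smul_eq_mul, nsmul_eq_mul, Nat.add_sub_cancel] at hD
      have h2 : lin w ^ k * (lin w * killDeriv v q +
          C (((k + 1 : ℕ) : K) * (v 1 * w 0 - v 0 * w 1)) * q) = 0 := by
        rw [← hD, C_mul, map_natCast]; ring
      have h3 := (mul_eq_zero.1 h2).resolve_left (pow_ne_zero _ hw)
      have hc : ((k + 1 : ℕ) : K) * (v 1 * w 0 - v 0 * w 1) ≠ 0 :=
        mul_ne_zero (Nat.cast_ne_zero.2 (Nat.succ_ne_zero k)) hvw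
      have h4 : lin w ∣ C (((k + 1 : ℕ) : K) * (v 1 * w 0 - v 0 * w 1)) * q :=
        ⟨-killDeriv v q, by linear_combination h3⟩
      have h5 : lin w ∣ q := ((hc.isUnit.map C).dvd_mul_left).1 h4
      rw [pow_succ]
      exact mul_dvd_mul_left _ h5
  exact eq_zero_of_pow_dvd (isHomogeneous_lin w) hf (Nat.lt_succ_self m) (all m)

/-- Forms of degree `m` in two variables divisible by high powers of pairwise non-proportional
linear forms are linearly independent as long as the dimension count permits. -/
theorem eq_zero_of_sum_eq_zero [CharZero K] {ι : Type*} [Fintype ι] (v : ι → Fin 2 → K)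
    (hv : ∀ i j, i ≠ j → v i 1 * v j 0 - v i 0 * v j 1 ≠ 0) (m : ℕ) (k : ι → ℕ)
    (hk : ∑ i, k i ≤ m + 1) (f : ι → MvPolynomial (Fin 2) K)
    (hf : ∀ i, (f i).IsHomogeneous m) (hdvd : ∀ i, lin (v i) ^ (m + 1 - k i) ∣ f i)
    (hsum : ∑ i, f i = 0) (i : ι) : f i = 0 := by
  classical
  induction m generalizing k f i with
  | zero =>
    by_cases hi : ∀ j, j ≠ i → k j = 0
    · have h0 : ∀ j, j ≠ i → f j = 0 := fun j hj =>
        eq_zero_of_pow_dvd (isHomogeneous_lin (v j)) (hf j) (by simp [hi j hj]) (hdvd j)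
      rwa [Finset.sum_eq_single i (fun j _ hj => h0 j hj) (by simp)] at hsum
    · push Not at hi
      obtain ⟨j, hji, hj⟩ := hi
      have h2 : k i + k j ≤ ∑ i, k i := by
        rw [← Finset.sum_pair hji.symm]
        exact Finset.sum_le_sum_of_subset (Finset.subset_univ _)
      exact eq_zero_of_pow_dvd (isHomogeneous_lin (v i)) (hf i) (by omega) (hdvd i)
  | succ m ih =>
    by_cases hall : ∀ j, k j = 0
    · exact eq_zero_of_pow_dvd (isHomogeneous_lin (v i)) (hf i) (by simp [hall i]) (hdvd i)
    · push Not at hall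
      obtain ⟨j, hj⟩ := hall
      have hpair : ∀ i, i ≠ j → k i + k j ≤ m + 2 := fun i hij => by
        refine le_trans ?_ hk
        rw [← Finset.sum_pair hij]
        exact Finset.sum_le_sum_of_subset (Finset.subset_univ _)
      -- Differentiating lowers the degree by one. The power of `lin (v j)` survives up to the new
      -- degree, so `k j` drops by one; every other power loses one factor, so `k i` is unchanged.
      have hD : ∀ i, killDeriv (v j) (f i) = 0 := by
        refine ih (Function.update k j (k j - 1)) ?_ (fun i => killDeriv (v j) (f i))
          (fun i => isHomogeneous_killDeriv _ (hf i)) (fun i => ?_) ?_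
        · rw [Finset.sum_update_of_mem (Finset.mem_univ j)]
          have := Finset.add_sum_erase Finset.univ k (Finset.mem_univ j)
          rw [Finset.erase_eq] at this
          omega
        · by_cases hij : i = j
          · subst hij
            rw [Function.update_self]
            refine pow_dvd_killDeriv_self _ ((pow_dvd_pow _ ?_).trans (hdvd i))
            omega
          · rw [Function.update_of_ne hij]
            refine (pow_dvd_pow _ ?_).trans (pow_dvd_derivation _ (hdvd i))
            omega
        · rw [← map_sum, hsum, map_zero]
      have h0 : ∀ i, i ≠ j → f i = 0 := fun i hij => by
        refine eq_zero_of_killDeriv_eq_zero (hv j i (Ne.symm hij)) (hf i) (hD i) ?_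
        refine (dvd_pow_self _ ?_).trans (hdvd i)
        have := hpair i hij
        omega
      by_cases hij : i = j
      · subst hij
        rwa [Finset.sum_eq_single i (fun j _ hj => h0 j hj) (by simp)] at hsum
      · exact h0 i hij

/-! ### Dimension count and spanning in two variables -/

theorem finrank_homogeneousSubmodule_fin_two (m : ℕ) :
    Module.finrank K (homogeneousSubmodule (Fin 2) K m) = m + 1 := by
  rw [homogeneousSubmodule_eq_finsupp_supported]
  let e : {d : Fin 2 →₀ ℕ | d.degree = m} ≃ Finset.HasAntidiagonal.antidiagonal m :=
    { toFun := fun d => ⟨(d.1 0, d.1 1), by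
        have := d.2
        rw [Set.mem_ofPred_eq, Finsupp.degree_eq_sum, Fin.sum_univ_two] at this
        simpa using this⟩
      invFun := fun p => ⟨Finsupp.equivFunOnFinite.symm ![p.1.1, p.1.2], by
        have := Finset.HasAntidiagonal.mem_antidiagonal.1 p.2
        rw [Set.mem_ofPred_eq, Finsupp.degree_eq_sum, Fin.sum_univ_two]
        simpa using this⟩
      left_inv := fun d => by
        apply Subtype.ext
        ext i
        fin_cases i <;> rfl
      right_inv := fun p => rfl }
  rw [((AddMonoidAlgebra.supportedEquivFinsupp {d : Fin 2 →₀ ℕ | d.degree = m}).trans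
    (Finsupp.domLCongr e)).finrank_eq, Module.finrank_finsupp_self]
  simp

theorem exists_le_sum_eq {ι : Type*} (s : Finset ι) (k : ι → ℕ) (N : ℕ) (h : N ≤ ∑ i ∈ s, k i) :
    ∃ k' : ι → ℕ, (∀ i, k' i ≤ k i) ∧ ∑ i ∈ s, k' i = N := by
  classical
  induction s using Finset.induction_on generalizing N with
  | empty => exact ⟨fun _ => 0, fun _ => Nat.zero_le _, by simp at h; simp [h]⟩
  | insert a s ha ih =>
    rw [Finset.sum_insert ha] at h
    obtain ⟨k', hk', hs⟩ := ih (N - min N (k a)) (by omega)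
    refine ⟨Function.update k' a (min N (k a)), fun i => ?_, ?_⟩
    · by_cases hi : i = a
      · subst hi; simp
      · rw [Function.update_of_ne hi]; exact hk' i
    · rw [Finset.sum_insert ha, Function.update_self, Finset.sum_update_of_notMem ha, hs]
      omega

/-- The forms of degree `m` in two variables divisible by `L ^ d`. -/
noncomputable def divisibleForms (L : MvPolynomial (Fin 2) K) (m d : ℕ) : Submodule K (MvPolynomial (Fin 2) K) :=
  homogeneousSubmodule (Fin 2) K m ⊓ (Ideal.span {L ^ d}).restrictScalars K

theorem mem_divisibleForms {L f : MvPolynomial (Fin 2) K} {m d : ℕ} :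
    f ∈ divisibleForms L m d ↔ f.IsHomogeneous m ∧ L ^ d ∣ f := by
  simp [divisibleForms, Ideal.mem_span_singleton]

theorem finiteDimensional_homogeneousSubmodule (m : ℕ) :
    FiniteDimensional K (homogeneousSubmodule (Fin 2) K m) :=
  Module.Finite.iff_fg.2 (homogeneousSubmodule_fg _ _ m)

theorem le_finrank_divisibleForms {w : Fin 2 → K} (hw : w ≠ 0) (m k : ℕ) (hk : k ≤ m + 1) :
    k ≤ Module.finrank K (divisibleForms (lin w) m (m + 1 - k)) := by
  have := finiteDimensional_homogeneousSubmodule (K := K) m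
  have : FiniteDimensional K (divisibleForms (lin w) m (m + 1 - k)) :=
    Submodule.finiteDimensional_of_le (inf_le_left : _ ≤ homogeneousSubmodule (Fin 2) K m)
  rcases Nat.eq_zero_or_pos k with rfl | hpos
  · exact Nat.zero_le _
  have hmaps : ∀ f ∈ homogeneousSubmodule (Fin 2) K (k - 1),
      LinearMap.mulLeft K (lin w ^ (m + 1 - k)) f ∈ divisibleForms (lin w) m (m + 1 - k) := by
    intro f hf
    refine mem_divisibleForms.2 ⟨?_, Dvd.intro _ rfl⟩
    have h := ((isHomogeneous_lin w).pow (m + 1 - k)).mul ((mem_homogeneousSubmodule _ _).1 hf)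
    rwa [show 1 * (m + 1 - k) + (k - 1) = m by omega] at h
  have hinj : Function.Injective
      ((LinearMap.mulLeft K (lin w ^ (m + 1 - k))).restrict hmaps) := by
    intro f g hfg
    have h1 := congrArg Subtype.val hfg
    simp only [LinearMap.restrict_apply, LinearMap.mulLeft_apply] at h1
    exact Subtype.ext (mul_left_cancel₀ (pow_ne_zero _ (lin_ne_zero hw)) h1)
  have h := LinearMap.finrank_le_finrank_of_injective hinj
  rw [finrank_homogeneousSubmodule_fin_two] at h
  omega

/-- Forms of degree `m` in two variables decompose along high powers of pairwise non-proportional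
linear forms as soon as the dimension count permits. -/
theorem exists_sum_eq [CharZero K] {ι : Type*} [Fintype ι] (v : ι → Fin 2 → K) (hv0 : ∀ i, v i ≠ 0)
    (hv : ∀ i j, i ≠ j → v i 1 * v j 0 - v i 0 * v j 1 ≠ 0) (m : ℕ) (k : ι → ℕ)
    (hkm : ∀ i, k i ≤ m + 1) (hk : m + 1 ≤ ∑ i, k i) {F : MvPolynomial (Fin 2) K}
    (hF : F.IsHomogeneous m) :
    ∃ f : ι → MvPolynomial (Fin 2) K,
      (∀ i, (f i).IsHomogeneous m ∧ lin (v i) ^ (m + 1 - k i) ∣ f i) ∧ ∑ i, f i = F := by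
  -- Trimming `k` to total exactly `m + 1` makes the sum map an injection between spaces of equal
  -- dimension.
  obtain ⟨k', hk', hsum⟩ := exists_le_sum_eq Finset.univ k (m + 1) hk
  have := finiteDimensional_homogeneousSubmodule (K := K) m
  let V : ι → Submodule K (MvPolynomial (Fin 2) K) :=
    fun i => divisibleForms (lin (v i)) m (m + 1 - k' i)
  have hle : ∀ i, V i ≤ homogeneousSubmodule (Fin 2) K m := fun i => inf_le_left
  have hfin : ∀ i, FiniteDimensional K (V i) := fun i => Submodule.finiteDimensional_of_le (hle i)
  let Φ : (∀ i, V i) →ₗ[K] homogeneousSubmodule (Fin 2) K m :=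
    ∑ i, (Submodule.inclusion (hle i)).comp (LinearMap.proj i)
  have hΦ : ∀ f, (Φ f : MvPolynomial (Fin 2) K) = ∑ i, (f i : MvPolynomial (Fin 2) K) := by
    intro f
    simp [Φ]
  have hinj : Function.Injective Φ := by
    rw [injective_iff_map_eq_zero]
    intro f hf
    have h0 : ∑ i, (f i : MvPolynomial (Fin 2) K) = 0 := by rw [← hΦ, hf]; rfl
    funext i
    exact Subtype.ext (eq_zero_of_sum_eq_zero v hv m k' hsum.le _
      (fun i => (mem_divisibleForms.1 (f i).2).1) (fun i => (mem_divisibleForms.1 (f i).2).2) h0 i)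
  have hdim : Module.finrank K (∀ i, V i) = Module.finrank K (homogeneousSubmodule (Fin 2) K m) := by
    refine le_antisymm (LinearMap.finrank_le_finrank_of_injective hinj) ?_
    rw [finrank_homogeneousSubmodule_fin_two, Module.finrank_pi_fintype, ← hsum]
    exact Finset.sum_le_sum fun i _ =>
      le_finrank_divisibleForms (hv0 i) m (k' i) ((hk' i).trans (hkm i))
  obtain ⟨f, hf⟩ := (LinearMap.injective_iff_surjective_of_finrank_eq_finrank hdim).1 hinj ⟨F, hF⟩
  refine ⟨fun i => f i, fun i => ?_, by rw [← hΦ, hf]⟩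
  obtain ⟨h1, h2⟩ := mem_divisibleForms.1 (f i).2
  exact ⟨h1, (pow_dvd_pow _ (Nat.sub_le_sub_left (hk' i) _)).trans h2⟩

/-! ### Restriction to a plane -/

/-- Restriction of polynomials in three variables to the plane `a₀ x + a₁ y + a₂ z = 0`,
parametrized by its first two coordinates. -/
noncomputable def restr (a : Fin 3 → K) :
    MvPolynomial (Fin 3) K →ₐ[K] MvPolynomial (Fin 2) K :=
  aeval ![X 0, X 1, C (-(a 0 / a 2)) * X 0 + C (-(a 1 / a 2)) * X 1]

/-- The inclusion `K[x, y] → K[x, y, z]`. -/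
noncomputable def sect : MvPolynomial (Fin 2) K →ₐ[K] MvPolynomial (Fin 3) K :=
  aeval ![X 0, X 1]

/-- The coefficient vector of the restriction of a linear form. -/
def restrVec (a u : Fin 3 → K) : Fin 2 → K :=
  ![u 0 - u 2 * (a 0 / a 2), u 1 - u 2 * (a 1 / a 2)]

theorem restr_lin (a u : Fin 3 → K) : restr a (lin u) = lin (restrVec a u) := by
  simp [restr, lin, restrVec, Fin.sum_univ_three, Fin.sum_univ_two, algebraMap_eq]
  ring

theorem restr_sect (a : Fin 3 → K) (f : MvPolynomial (Fin 2) K) : restr a (sect f) = f := by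
  have : (restr a).comp sect = AlgHom.id K _ := by
    apply MvPolynomial.algHom_ext
    intro i
    fin_cases i <;> simp [restr, sect]
  exact DFunLike.congr_fun this f

theorem isHomogeneous_restr (a : Fin 3 → K) {f : MvPolynomial (Fin 3) K} {m : ℕ}
    (hf : f.IsHomogeneous m) : (restr a f).IsHomogeneous m := by
  have h := hf.aeval (n := 1)
    (g := (![X 0, X 1, C (-(a 0 / a 2)) * X 0 + C (-(a 1 / a 2)) * X 1] :
      Fin 3 → MvPolynomial (Fin 2) K)) (fun i => by
    fin_cases i
    · exact isHomogeneous_X _ _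
    · exact isHomogeneous_X _ _
    · exact (isHomogeneous_C_mul_X _ _).add (isHomogeneous_C_mul_X _ _))
  rw [one_mul] at h
  exact h

/-- Modulo `lin a`, the variable `z` equals the combination of `x` and `y` substituted for it; hence
the kernel of `restr a` is generated by `lin a`. -/
theorem lin_dvd_sub_sect_restr {a : Fin 3 → K} (ha : a 2 ≠ 0) (f : MvPolynomial (Fin 3) K) :
    lin a ∣ f - sect (restr a f) := by
  have key : (Ideal.Quotient.mkₐ K (Ideal.span {lin a})).comp (sect.comp (restr a)) =
      Ideal.Quotient.mkₐ K (Ideal.span {lin a}) := by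
    apply MvPolynomial.algHom_ext
    intro i
    fin_cases i
    · simp [restr, sect]
    · simp [restr, sect]
    · refine (Ideal.Quotient.eq.2 (Ideal.mem_span_singleton.2 ⟨C (-(1 / a 2)), ?_⟩))
      have h1 : (C (a 2) * C (1 / a 2) : MvPolynomial (Fin 3) K) = 1 := by
        rw [← C_mul, mul_one_div_cancel ha, C_1]
      simp only [restr, sect, lin, Fin.sum_univ_three, div_eq_mul_one_div (a _) (a 2), C_mul,
        C_neg]
      simp [algebraMap_eq] at h1 ⊢
      linear_combination X 2 * h1
  rw [← Ideal.mem_span_singleton, ← Ideal.Quotient.eq]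
  exact (DFunLike.congr_fun key f).symm

theorem restr_lin_self {a : Fin 3 → K} (ha : a 2 ≠ 0) : restr a (lin a) = 0 := by
  have : restrVec a a = 0 := by
    ext i
    fin_cases i <;> simp [restrVec] <;> field_simp <;> simp
  rw [restr_lin, this]
  simp [lin]

theorem lin_dvd_of_restr_eq_zero {a : Fin 3 → K} (ha : a 2 ≠ 0) {f : MvPolynomial (Fin 3) K}
    (hf : restr a f = 0) : lin a ∣ f := by
  simpa [hf] using lin_dvd_sub_sect_restr ha f

/-! ### The Lefschetz criterion -/

theorem injective_mulMap {r : ℕ} {I : Ideal (MvPolynomial (Fin r) K)} {a : Fin r → K} {m : ℕ}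
    (h : ∀ f : MvPolynomial (Fin r) K, f.IsHomogeneous m → lin a * f ∈ I → f ∈ I) :
    Function.Injective (mulMap I (linearForm a) m) := by
  rw [injective_iff_map_eq_zero]
  rintro ⟨_, f, hf, rfl⟩ h0
  have h1 := congrArg Subtype.val h0
  simp only [mulMap, LinearMap.restrict_apply, LinearMap.mulLeft_apply, coe_linearForm] at h1
  exact Subtype.ext (Ideal.Quotient.eq_zero_iff_mem.2
    (h f hf (Ideal.Quotient.eq_zero_iff_mem.1 ((map_mul _ _ _).trans h1))))

theorem surjective_mulMap {r : ℕ} {I : Ideal (MvPolynomial (Fin r) K)} {a : Fin r → K} {m : ℕ}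
    (h : ∀ F : MvPolynomial (Fin r) K, F.IsHomogeneous (m + 1) →
      ∃ G : MvPolynomial (Fin r) K, G.IsHomogeneous m ∧ lin a * G - F ∈ I) :
    Function.Surjective (mulMap I (linearForm a) m) := by
  rintro ⟨_, F, hF, rfl⟩
  obtain ⟨G, hG, hGF⟩ := h F hF
  refine ⟨⟨_, G, hG, rfl⟩, Subtype.ext ?_⟩
  simp only [mulMap, LinearMap.restrict_apply, LinearMap.mulLeft_apply, coe_linearForm]
  exact (map_mul _ _ _).symm.trans (Ideal.Quotient.eq.2 hGF)

/-- A linear form to whose zero locus the given linear forms restrict to nonzero, pairwise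
non-proportional forms is a weak Lefschetz element for the ideal generated by their powers. -/
theorem isLefschetzForm_of_restrVec [CharZero K] {ι : Type*} [Fintype ι] (u : ι → Fin 3 → K)
    (d : ι → ℕ) {a : Fin 3 → K} (ha : a 2 ≠ 0) (h0 : ∀ i, restrVec a (u i) ≠ 0)
    (hv : ∀ i j, i ≠ j → restrVec a (u i) 1 * restrVec a (u j) 0 -
      restrVec a (u i) 0 * restrVec a (u j) 1 ≠ 0) :
    IsLefschetzForm (Ideal.span (Set.range fun i => lin (u i) ^ d i)) (linearForm a) := by
  intro m
  have ha0 : lin a ≠ 0 := lin_ne_zero fun h => ha (by simp [h])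
  have hpow : ∀ i, (lin (u i) ^ d i).IsHomogeneous (d i) := fun i => by
    simpa using (isHomogeneous_lin (u i)).pow (d i)
  -- The summand is the dimension of the multiples of a `d i`-th power among binary forms of degree
  -- `m + 1`; truncation gives zero when `d i` exceeds the degree.
  rcases le_total (∑ i, (m + 1 + 1 - d i)) (m + 1 + 1) with hle | hge
  · left
    refine injective_mulMap fun f hf hmem => ?_
    obtain ⟨c, hc⟩ := Ideal.mem_span_range_iff_exists_fun.1 hmem
    let g : ι → MvPolynomial (Fin 3) K :=
      fun i => if d i ≤ m + 1 then homogeneousComponent (m + 1 - d i) (c i) else 0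
    have hg : ∀ i, homogeneousComponent (m + 1) (c i * lin (u i) ^ d i) = g i * lin (u i) ^ d i :=
      fun i => homogeneousComponent_mul_of_isHomogeneous (hpow i) _ _
    have hsum : ∑ i, g i * lin (u i) ^ d i = lin a * f := by
      have hh : (lin a * f).IsHomogeneous (m + 1) := by
        rw [add_comm m 1]; exact (isHomogeneous_lin a).mul hf
      rw [← homogeneousComponent_eq_self hh, ← hc, map_sum]
      exact Finset.sum_congr rfl fun i _ => (hg i).symm
    have hzero : ∀ i, restr a (g i * lin (u i) ^ d i) = 0 := by
      refine eq_zero_of_sum_eq_zero (fun i => restrVec a (u i)) hv (m + 1)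
        (fun i => m + 1 + 1 - d i) hle _
        (fun i => isHomogeneous_restr a ?_) (fun i => ?_) ?_
      · rw [← hg]; exact homogeneousComponent_isHomogeneous _ _
      · by_cases hd : d i ≤ m + 1
        · rw [map_mul, map_pow, restr_lin, show m + 1 + 1 - (m + 1 + 1 - d i) = d i by omega]
          exact Dvd.intro_left _ rfl
        · simp [g, hd]
      · rw [← map_sum, hsum, map_mul, restr_lin_self ha, zero_mul]
    have hdvd : ∀ i, ∃ g', g i = lin a * g' := fun i => by
      refine lin_dvd_of_restr_eq_zero ha ?_
      have h := hzero i
      rw [map_mul, map_pow, restr_lin] at h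
      exact (mul_eq_zero.1 h).resolve_right (pow_ne_zero _ (lin_ne_zero (h0 i)))
    choose g' hg' using hdvd
    refine Ideal.mem_span_range_iff_exists_fun.2 ⟨g', mul_left_cancel₀ ha0 ?_⟩
    rw [← hsum, Finset.mul_sum]
    exact Finset.sum_congr rfl fun i _ => by rw [hg', mul_assoc]
  · right
    refine surjective_mulMap fun F hF => ?_
    obtain ⟨f, hf, hsum⟩ := exists_sum_eq (fun i => restrVec a (u i)) h0 hv (m + 1)
      (fun i => m + 1 + 1 - d i) (fun i => Nat.sub_le _ _) hge (isHomogeneous_restr a hF)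
    have hdvd : ∀ i, ∃ q, f i = lin (restrVec a (u i)) ^ d i * q := fun i => by
      by_cases hd : d i ≤ m + 1 + 1
      · have h := (hf i).2
        rwa [show m + 1 + 1 - (m + 1 + 1 - d i) = d i by omega] at h
      -- Here truncation only gives divisibility by a power of exponent `m + 2`, which still exceeds
      -- the degree of `f i`.
      · refine ⟨0, ?_⟩
        rw [mul_zero]
        exact eq_zero_of_pow_dvd (isHomogeneous_lin _) (hf i).1 (by omega) (hf i).2
    choose q hq using hdvd
    have hker : restr a (F - ∑ i, sect (q i) * lin (u i) ^ d i) = 0 := by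
      rw [map_sub, map_sum, ← hsum, sub_eq_zero]
      refine Finset.sum_congr rfl fun i _ => ?_
      rw [map_mul, map_pow, restr_lin, restr_sect, hq, mul_comm]
    obtain ⟨G, hG⟩ := lin_dvd_of_restr_eq_zero ha hker
    refine ⟨homogeneousComponent m G, homogeneousComponent_isHomogeneous _ _, ?_⟩
    have h1 := congrArg (homogeneousComponent (m + 1)) hG
    rw [map_sub, homogeneousComponent_eq_self hF, map_sum, mul_comm (lin a),
      homogeneousComponent_mul_of_isHomogeneous (isHomogeneous_lin a), if_pos (by omega),
      Nat.add_sub_cancel, mul_comm] at h1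
    rw [← h1, sub_sub_cancel_left]
    refine neg_mem (Ideal.sum_mem _ fun i _ => ?_)
    rw [homogeneousComponent_mul_of_isHomogeneous (hpow i)]
    exact Ideal.mul_mem_left _ _ (Ideal.subset_span ⟨i, rfl⟩)

/-! ### General position and reduction of the generators -/

/-- The polynomial in `a` whose values are the determinants of `a`, `u`, `w`. -/
noncomputable def detPoly (u w : Fin 3 → K) : MvPolynomial (Fin 3) K :=
  lin (crossProduct u w)

theorem eval_detPoly {a : Fin 3 → K} (ha : a 2 ≠ 0) (u w : Fin 3 → K) :
    eval a (detPoly u w) = a 2 * (restrVec a u 0 * restrVec a w 1 -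
      restrVec a u 1 * restrVec a w 0) := by
  simp [detPoly, lin, cross_apply, restrVec, Fin.sum_univ_three]
  field_simp
  ring

theorem exists_crossProduct_ne_zero {u : Fin 3 → K} (hu : u ≠ 0) :
    ∃ w, crossProduct u w ≠ 0 := by
  by_contra! h
  apply hu
  have h1 := h ![1, 0, 0]
  have h2 := h ![0, 1, 0]
  rw [cross_apply] at h1 h2
  have e1 := congrFun h1 1
  have e2 := congrFun h1 2
  have e3 := congrFun h2 2
  simp at e1 e2 e3
  ext i
  fin_cases i <;> simp [*]

theorem exists_smul_of_crossProduct_eq_zero {u w : Fin 3 → K} (hw : w ≠ 0)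
    (h : crossProduct u w = 0) : ∃ c : K, u = c • w := by
  rw [cross_apply] at h
  have e0 := congrFun h 0
  have e1 := congrFun h 1
  have e2 := congrFun h 2
  simp at e0 e1 e2
  obtain ⟨i, hi⟩ := Function.ne_iff.1 hw
  refine ⟨u i / w i, ?_⟩
  ext j
  simp only [Pi.smul_apply, smul_eq_mul, Pi.zero_apply] at hi ⊢
  rw [div_mul_eq_mul_div, eq_div_iff hi]
  fin_cases i <;> fin_cases j <;> simp <;>
    first | linear_combination e0 | linear_combination -e0 | linear_combination e1 |
      linear_combination -e1 | linear_combination e2 | linear_combination -e2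

/-- An ideal generated by powers of linear forms is generated by powers of nonzero, pairwise
non-proportional ones among them. -/
theorem exists_finset_span_eq {n : ℕ} (u : Fin n → Fin 3 → K) (d : Fin n → ℕ)
    (hd : ∀ i, d i ≠ 0) :
    ∃ T : Finset (Fin n),
      Ideal.span (Set.range fun i : T => lin (u i) ^ d i) =
        Ideal.span (Set.range fun i => lin (u i) ^ d i) ∧
      (∀ i ∈ T, u i ≠ 0) ∧
      ∀ i ∈ T, ∀ j ∈ T, i ≠ j → crossProduct (u i) (u j) ≠ 0 := by
  classical
  let f : Fin n → MvPolynomial (Fin 3) K := fun i => lin (u i) ^ d i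
  -- In a minimal generating subset no two forms are proportional: the higher power would be a
  -- multiple of the lower.
  obtain ⟨T, hT⟩ := exists_minimal_of_wellFoundedLT
    (fun T : Finset (Fin n) => Ideal.span (f '' T) = Ideal.span (Set.range f))
    ⟨Finset.univ, by simp⟩
  have hmin : ∀ i ∈ T, f i ∉ Ideal.span (f '' (T.erase i : Finset (Fin n))) := by
    intro i hi hmem
    refine hT.not_prop_of_lt (Finset.erase_ssubset hi) (le_antisymm
      (Ideal.span_mono (Set.image_subset_range _ _)) ?_)
    rw [← hT.prop, Ideal.span_le]
    rintro _ ⟨j, hj, rfl⟩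
    by_cases hji : j = i
    · subst hji; exact hmem
    · exact Ideal.subset_span ⟨j, by simpa [hji] using hj, rfl⟩
  have hne : ∀ i ∈ T, u i ≠ 0 := by
    intro i hi h0
    apply hmin i hi
    -- A zero exponent would give `0 ^ 0 = 1`; that case is the unit ideal.
    have : f i = 0 := by simp [f, h0, lin, hd i]
    rw [this]
    exact zero_mem _
  have hsmul : ∀ i ∈ T, ∀ j ∈ T, i ≠ j → d j ≤ d i → ∀ c : K, u i ≠ c • u j := by
    intro i hi j hj hij hdij c hc
    apply hmin i hi
    have h1 : f j ∣ f i := by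
      simp only [f]
      rw [hc, lin_smul, mul_pow]
      exact (pow_dvd_pow _ hdij).mul_left _
    exact Ideal.mem_of_dvd _ h1 (Ideal.subset_span ⟨j, by simpa [hij.symm] using hj, rfl⟩)
  refine ⟨T, ?_, hne, fun i hi j hj hij h => ?_⟩
  · rw [← hT.prop, Set.image_eq_range]
    rfl
  · rcases le_total (d j) (d i) with hdij | hdij
    · obtain ⟨c, hc⟩ := exists_smul_of_crossProduct_eq_zero (hne j hj) h
      exact hsmul i hi j hj hij hdij c hc
    · have h' : crossProduct (u j) (u i) = 0 := by rw [← cross_anticomm, h, neg_zero]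
      obtain ⟨c, hc⟩ := exists_smul_of_crossProduct_eq_zero (hne i hi) h'
      exact hsmul j hj i hi hij.symm hdij c hc

theorem forGeneralLinearForm_isLefschetzForm [CharZero K] {ι : Type*} [Fintype ι]
    (u : ι → Fin 3 → K) (d : ι → ℕ) (h0 : ∀ i, u i ≠ 0)
    (hu : ∀ i j, i ≠ j → crossProduct (u i) (u j) ≠ 0) :
    ForGeneralLinearForm
      (IsLefschetzForm (Ideal.span (Set.range fun i => lin (u i) ^ d i))) := by
  classical
  -- The determinant of `a`, `u i`, `w i` being nonzero forces `u i` to restrict to a nonzero form.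
  choose w hw using fun i => exists_crossProduct_ne_zero (h0 i)
  refine ⟨X 2 * (∏ i, detPoly (u i) (w i)) *
    ∏ i, ∏ j, if i = j then 1 else detPoly (u i) (u j), ?_, fun a ha => ?_⟩
  · refine mul_ne_zero (mul_ne_zero (X_ne_zero 2)
      (Finset.prod_ne_zero_iff.2 fun i _ => lin_ne_zero (hw i)))
      (Finset.prod_ne_zero_iff.2 fun i _ => Finset.prod_ne_zero_iff.2 fun j _ => ?_)
    split_ifs with hij
    · exact one_ne_zero
    · exact lin_ne_zero (hu i j hij)
  · rw [map_mul, map_mul, eval_X, map_prod, map_prod] at ha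
    have ha2 := left_ne_zero_of_mul (left_ne_zero_of_mul ha)
    have haw := Finset.prod_ne_zero_iff.1 (right_ne_zero_of_mul (left_ne_zero_of_mul ha))
    have hau := Finset.prod_ne_zero_iff.1 (right_ne_zero_of_mul ha)
    refine isLefschetzForm_of_restrVec u d ha2 (fun i hi => ?_) fun i j hij h => ?_
    · apply haw i (Finset.mem_univ i)
      rw [eval_detPoly ha2, hi]
      simp
    · have hi := hau i (Finset.mem_univ i)
      rw [map_prod] at hi
      have hj := Finset.prod_ne_zero_iff.1 hi j (Finset.mem_univ j)
      rw [if_neg hij, eval_detPoly ha2] at hj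
      exact hj (by linear_combination (-a 2) * h)

theorem ForGeneralLinearForm.exists [Infinite K] {r : ℕ}
    {p : homogeneousSubmodule (Fin r) K 1 → Prop} (h : ForGeneralLinearForm p) : ∃ ℓ, p ℓ := by
  obtain ⟨P, hP, hp⟩ := h
  by_contra! hne
  refine hP (MvPolynomial.funext fun a => ?_)
  by_contra ha
  exact hne _ (hp a (by simpa using ha))

theorem isLefschetzForm_top {r : ℕ} (ℓ : homogeneousSubmodule (Fin r) K 1) :
    IsLefschetzForm ⊤ ℓ := fun _ => Or.inl fun _ _ _ =>
  Subtype.ext ((Ideal.Quotient.subsingleton_iff.2 rfl).elim _ _)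

end WeakLefschetz

theorem theorem2p4 {K : Type*} [Field K] [CharZero K] {n : ℕ}
    (l : Fin n → MvPolynomial (Fin 3) K) (hl : ∀ i, (l i).IsHomogeneous 1) (d : Fin n → ℕ)
    (I : Ideal (MvPolynomial (Fin 3) K)) (hI : I = Ideal.span (Set.range fun i => l i ^ d i))
    (hA : IsArtinianRing (MvPolynomial (Fin 3) K ⧸ I)) :
    WeakLefschetz.HasWLP I ∧
      WeakLefschetz.ForGeneralLinearForm (WeakLefschetz.IsLefschetzForm I) := by
  have key : WeakLefschetz.ForGeneralLinearForm (WeakLefschetz.IsLefschetzForm I) := by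
    by_cases hd : ∀ i, d i ≠ 0
    · choose u hu using fun i => WeakLefschetz.exists_eq_lin (hl i)
      obtain ⟨T, hspan, hne, hcross⟩ := WeakLefschetz.exists_finset_span_eq u d hd
      simp only [hu] at hI
      rw [hI, ← hspan]
      exact WeakLefschetz.forGeneralLinearForm_isLefschetzForm (fun i : T => u i) (fun i : T => d i)
        (fun i => hne i i.2) fun i j hij => hcross i i.2 j j.2 fun h => hij (Subtype.ext h)
    · push Not at hd
      obtain ⟨i, hi⟩ := hd
      have htop : I = ⊤ := by
        rw [Ideal.eq_top_iff_one, hI]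
        exact Ideal.subset_span ⟨i, by simp [hi]⟩
      rw [htop]
      exact ⟨1, one_ne_zero, fun a _ => WeakLefschetz.isLefschetzForm_top _⟩
  exact ⟨key.exists, key⟩
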